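/- An element $a$ of a $*$-ring $R$ is called Moore--Penrose invertible if there is $b \in R$ with $aba = a$, $bab = b$, $(ab)^* = ab$ and $(ba)^* = ba$. A $C^*$-algebra is called elementary if it is $*$-isomorphic to the algebra $K(H)$ of compact operators on some (complex) Hilbert space $H$, and dual if it is $*$-isomorphic to a direct sum $\bigoplus_{t \in T} \mathcal{K}_t$ of elementary $C^*$-algebras, where the direct sum consists of all families $(k_t)_{t \in T}$ with $k_t \in \mathcal{K}_t$ such that $\{t \in T : \|k_t\| \ge \varepsilon\}$ is finite for every $\varepsilon > 0$. A closed two-sided ideal of a $C^*$-algebra is called a dual ideal if it is dual when considered as a $C^*$-algebra. Theorem. Let $\mathcal{A}$ be a unital $C^*$-algebra, $\mathcal{J}$ a dual ideal of $\mathcal{A}$, and $a \in \mathcal{A}$. Then the coset $a + \mathcal{J}$ is Moore--Penrose invertible in $\mathcal{A}/\mathcal{J}$ (with the involution $(x + \mathcal{J})^* = x^* + \mathcal{J}$) if and only if there are a Moore--Penrose invertible element $m \in \mathcal{A}$ and an element $j \in \mathcal{J}$ with $a = m + j$. -/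

import Mathlib

universe u v w z

noncomputable section

open Filter Topology

/-- `a` is Moore-Penrose invertible: there is `b` with `a b a = a`, `b a b = b` and `a b`, `b a`
self-adjoint. -/
def IsMoorePenroseInvertible {R : Type*} [Mul R] [Star R] (a : R) : Prop :=
  ∃ b : R, a * b * a = a ∧ b * a * b = b ∧ IsSelfAdjoint (a * b) ∧ IsSelfAdjoint (b * a)

/-! ### Elementary and dual algebras -/

section Compact

variable (H : Type*) [NormedAddCommGroup H] [InnerProductSpace ℂ H] [CompleteSpace H]

/-- The adjoint of a compact operator on a Hilbert space is compact. -/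
theorem isCompactOperator_star {T : H →L[ℂ] H} (hT : IsCompactOperator T) :
    IsCompactOperator (star T : H →L[ℂ] H) := by
  have hS : IsCompactOperator (T * star T : H →L[ℂ] H) := hT.comp_clm (star T)
  have key : ∀ x : H, ‖(star T) x‖ ^ 2 ≤ ‖(T * star T) x‖ * ‖x‖ := by
    intro x
    have h1 : inner ℂ ((star T) x) ((star T) x) = inner ℂ ((T * star T) x) x := by
      rw [ContinuousLinearMap.star_eq_adjoint, ContinuousLinearMap.adjoint_inner_right]
      rfl
    have h2 : ‖inner ℂ ((star T) x) ((star T) x)‖ = ‖(star T) x‖ ^ 2 := by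
      rw [inner_self_eq_norm_sq_to_K]
      simp
    rw [← h2, h1]
    exact norm_inner_le_norm _ _
  have hb : TotallyBounded ((T * star T : H →L[ℂ] H) '' Metric.closedBall 0 1) := by
    have := hS.isCompact_closure_image_closedBall (1 : ℝ)
    exact this.totallyBounded.subset subset_closure
  have hc : TotallyBounded ((star T : H →L[ℂ] H) '' Metric.closedBall 0 1) := by
    rw [Metric.totallyBounded_iff]
    intro ε hε
    have hε2 : 0 < ε ^ 2 / 2 / 2 := by positivity
    obtain ⟨t, hts, htf, htc⟩ := Metric.finite_approx_of_totallyBounded hb (ε ^ 2 / 2 / 2) hε2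
    choose! g hg using fun y (hy : y ∈ t) => hts hy
    refine ⟨(fun y => (star T) (g y)) '' t, htf.image _, ?_⟩
    rintro _ ⟨x, hx, rfl⟩
    obtain ⟨y, hy, hxy⟩ := Set.mem_iUnion₂.1 (htc ⟨x, hx, rfl⟩)
    refine Set.mem_iUnion₂.2 ⟨_, ⟨y, hy, rfl⟩, ?_⟩
    have hgy := hg y hy
    rw [Metric.mem_ball, dist_eq_norm, ← hgy.2, ← map_sub] at hxy
    rw [Metric.mem_ball, dist_eq_norm, ← map_sub]
    have hn : ‖x - g y‖ ≤ 2 := by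
      have h1 : ‖x‖ ≤ 1 := by simpa using hx
      have h2 : ‖g y‖ ≤ 1 := by simpa using hgy.1
      linarith [norm_sub_le x (g y)]
    have hk := key (x - g y)
    have : ‖(star T) (x - g y)‖ ^ 2 < ε ^ 2 := by
      nlinarith [norm_nonneg ((T * star T) (x - g y)), norm_nonneg (x - g y)]
    exact lt_of_pow_lt_pow_left₀ 2 hε.le this
  have := (isCompactOperator_iff_isCompact_closure_image_closedBall
    ((star T : H →L[ℂ] H) : H →ₗ[ℂ] H) (zero_lt_one)).2
    (hc.closure.isCompact_of_isClosed isClosed_closure)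
  exact this

/-- `K(H)`, the algebra of compact operators on the Hilbert space `H`. -/
def compactOperators : NonUnitalStarSubalgebra ℂ (H →L[ℂ] H) where
  carrier := {T | IsCompactOperator T}
  add_mem' ha hb := ha.add hb
  zero_mem' := isCompactOperator_zero
  mul_mem' {_ b} ha _ := ha.comp_clm b
  smul_mem' c _ ha := ha.smul c
  star_mem' ha := isCompactOperator_star H ha

end Compact

/-- A *-algebra over `ℂ` is elementary if it is *-isomorphic to `K(H)` for a Hilbert space `H`. -/
def IsElementary (B : Type u) [NonUnitalRing B] [StarRing B] [Module ℂ B] : Prop :=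
  ∃ (H : Type v) (_ : NormedAddCommGroup H) (_ : InnerProductSpace ℂ H) (_ : CompleteSpace H),
    Nonempty (B ≃⋆ₐ[ℂ] compactOperators H)

/-- The direct sum of a family of C*-algebras: all families `(x t)` with `‖x t‖ → 0`, that is, such
that `{t | ε ≤ ‖x t‖}` is finite for every `ε > 0`, with the pointwise operations. -/
def cstarDirectSum {T : Type*} (B : T → Type*) [∀ t, NonUnitalCStarAlgebra (B t)] :
    NonUnitalStarSubalgebra ℂ (∀ t, B t) where
  carrier := {x | Tendsto (fun t => ‖x t‖) cofinite (𝓝 0)}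
  add_mem' {x y} hx hy := by
    have h : Tendsto (fun t => ‖x t‖ + ‖y t‖) cofinite (𝓝 0) := by simpa using hx.add hy
    exact squeeze_zero (fun _ => norm_nonneg _) (fun t => norm_add_le (x t) (y t)) h
  zero_mem' := by
    have h : Tendsto (fun _ : T => (0 : ℝ)) cofinite (𝓝 0) := tendsto_const_nhds
    simpa using h
  mul_mem' {x y} hx hy := by
    have h : Tendsto (fun t => ‖x t‖ * ‖y t‖) cofinite (𝓝 0) := by simpa using hx.mul hy
    exact squeeze_zero (fun _ => norm_nonneg _) (fun t => norm_mul_le (x t) (y t)) h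
  smul_mem' c x hx := by
    have h : Tendsto (fun t => ‖c‖ * ‖x t‖) cofinite (𝓝 0) := by simpa using hx.const_mul ‖c‖
    exact squeeze_zero (fun _ => norm_nonneg _) (fun t => norm_smul_le c (x t)) h
  star_mem' {x} hx := by simpa using hx

/-- A *-algebra over `ℂ` is dual if it is *-isomorphic to a direct sum of elementary C*-algebras. -/
def IsDualAlgebra (B : Type u) [NonUnitalRing B] [StarRing B] [Module ℂ B] : Prop :=
  ∃ (T : Type v) (K : T → Type w) (_ : ∀ t, NonUnitalCStarAlgebra (K t)),
    (∀ t, IsElementary.{w, z} (K t)) ∧ Nonempty (B ≃⋆ₐ[ℂ] cstarDirectSum K)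

/-! ### Closed ideals, and the quotients by them -/

/-- `J` is a closed (two-sided) ideal. -/
class IsClosedIdeal {A : Type*} [Ring A] [TopologicalSpace A] (J : Ideal A) : Prop
    extends J.IsTwoSided where
  isClosed : IsClosed (J : Set A)

section ClosedIdeal

variable {A : Type*} [CStarAlgebra A] (J : Ideal A) [IsClosedIdeal J]

/-- Closed ideals of C*-algebras are self-adjoint. -/
theorem IsClosedIdeal.star_mem {a : A} (ha : a ∈ J) : star a ∈ J := by
  have hcl : IsClosed (J : Set A) := IsClosedIdeal.isClosed
  change star a ∈ (J : Set A)
  rw [← hcl.closure_eq, Metric.mem_closure_iff]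
  intro ε hε
  set h : A := a * star a with hh
  have hsa : IsSelfAdjoint h := IsSelfAdjoint.mul_star_self a
  have hJ : h ∈ J := J.mul_mem_right _ ha
  set δ : ℝ := ε ^ 2 with hδ
  have hδ0 : 0 < δ := by positivity
  have hpos : ∀ t : ℝ, t ^ 2 + δ ^ 2 ≠ 0 := fun t => by positivity
  set g : ℝ → ℝ := fun t => t / (t ^ 2 + δ ^ 2) with hg
  have hgc : Continuous g := by
    rw [hg]
    exact continuous_id.div (by fun_prop) hpos
  set k : ℝ → ℝ := fun t => δ ^ 2 / (t ^ 2 + δ ^ 2) with hk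
  have hkc : Continuous k := by
    rw [hk]
    exact continuous_const.div (by fun_prop) hpos
  have hone : h * cfc g h + cfc k h = 1 := by
    have h1 : h * cfc g h = cfc (fun t : ℝ => t * g t) h := by
      conv_lhs => rw [← cfc_id' ℝ h]
      rw [cfc_id' ℝ h, cfc_mul (fun t : ℝ => t) g h (by fun_prop) hgc.continuousOn, cfc_id' ℝ h]
    rw [h1, ← cfc_add h (fun t : ℝ => t * g t) k (by fun_prop) hkc.continuousOn,
      ← cfc_one ℝ h]
    refine cfc_congr fun t _ => ?_
    simp only [hg, hk, Pi.one_apply]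
    have := hpos t
    field_simp
  have hksa : star (cfc k h) = cfc k h := (cfc_predicate k h : IsSelfAdjoint (cfc k h)).star_eq
  refine ⟨star a * (h * cfc g h), J.mul_mem_left _ (J.mul_mem_right _ hJ), ?_⟩
  have hd : star a - star a * (h * cfc g h) = star a * cfc k h := by
    rw [eq_sub_of_add_eq hone, mul_sub, mul_one, sub_sub_cancel]
  rw [dist_eq_norm, hd]
  have hprod : star (star a * cfc k h) * (star a * cfc k h) =
      cfc (fun t : ℝ => k t * (t * k t)) h := by
    rw [cfc_mul k (fun t : ℝ => t * k t) h hkc.continuousOn (by fun_prop),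
      cfc_mul (fun t : ℝ => t) k h (by fun_prop) hkc.continuousOn, cfc_id' ℝ h, star_mul,
      star_star, hksa, hh]
    simp only [mul_assoc]
  have hn : ‖cfc (fun t : ℝ => k t * (t * k t)) h‖ ≤ δ / 2 := by
    refine norm_cfc_le (by positivity) fun t _ => ?_
    have hp : 0 < t ^ 2 + δ ^ 2 := by positivity
    have hk0 : 0 ≤ k t := by positivity
    have hk1 : k t ≤ 1 := by
      simp only [hk]
      rw [div_le_one hp]
      nlinarith [sq_nonneg t]
    have hk2 : |t| * k t ≤ δ / 2 := by
      simp only [hk]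
      rw [mul_div_assoc', div_le_iff₀ hp]
      have : 0 ≤ (|t| - δ) ^ 2 := sq_nonneg _
      have h3 : |t| ^ 2 = t ^ 2 := sq_abs t
      nlinarith
    rw [Real.norm_eq_abs, abs_mul, abs_mul, abs_of_nonneg hk0]
    calc k t * (|t| * k t) ≤ 1 * (|t| * k t) := by gcongr
      _ ≤ δ / 2 := by rw [one_mul]; exact hk2
  have hsq : ‖star a * cfc k h‖ ^ 2 < ε ^ 2 := by
    rw [sq, ← CStarRing.norm_star_mul_self, hprod]
    linarith
  exact lt_of_pow_lt_pow_left₀ 2 hε.le hsq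

/-- The involution `(a + J)* = a* + J` on the quotient by a closed ideal. -/
instance IsClosedIdeal.instStarRingQuotient : StarRing (A ⧸ J) where
  star := Quotient.map' star fun a b hab => by
    rw [Submodule.quotientRel_def] at hab ⊢
    rw [← star_sub]
    exact IsClosedIdeal.star_mem J hab
  star_involutive := by
    rintro ⟨a⟩
    exact congrArg (Ideal.Quotient.mk J) (star_star a)
  star_mul := by
    rintro ⟨a⟩ ⟨b⟩
    exact congrArg (Ideal.Quotient.mk J) (star_mul a b)
  star_add := by
    rintro ⟨a⟩ ⟨b⟩
    exact congrArg (Ideal.Quotient.mk J) (star_add a b)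

theorem IsClosedIdeal.star_mk (a : A) :
    star (Ideal.Quotient.mk J a) = Ideal.Quotient.mk J (star a) := rfl

/-- A closed ideal of a C*-algebra, as a C*-subalgebra. -/
def IsClosedIdeal.toStarSubalgebra : NonUnitalStarSubalgebra ℂ A where
  carrier := J
  add_mem' := J.add_mem
  zero_mem' := J.zero_mem
  mul_mem' _ hb := J.mul_mem_left _ hb
  smul_mem' c x hx := by
    have h : c • x = (c • (1 : A)) * x := by simp
    rw [h]
    exact J.mul_mem_left _ hx
  star_mem' ha := IsClosedIdeal.star_mem J ha

/-- A closed ideal is a dual ideal if it is a dual algebra. -/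
def IsDualIdeal {A : Type u} [CStarAlgebra A] (J : Ideal A) [IsClosedIdeal J] : Prop :=
  IsDualAlgebra.{u, v, w, z} (IsClosedIdeal.toStarSubalgebra J)

end ClosedIdeal

end

open Filter Topology

/-! Let `b + J` be a Moore-Penrose inverse of `a + J`, and put `h = a* a`, `c = b b*`. Modulo `J`,
`a = a cⁿ hⁿ` for every `n`. If `k` vanishes on `[δ, ∞)` with `‖c‖ δ < 1`, then `a cⁿ hⁿ k(h) → 0`,
so `a k(h) ∈ J` because `J` is closed (`mul_cfc_mem_of_eqOn_zero`). Hence `J` contains some `f(h)`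
with `f = 1` on an interval inside `(0, δ)`. If the spectrum of `h` filled that interval, bump
functions with disjoint supports in it would yield infinitely many nonzero orthogonal elements with
right unit `f(h)`, which a dual algebra forbids (`IsDualAlgebra.finitelyManyOrthogonalBelow`). So
the spectrum has a gap `s`; cutting `a` there gives `m` from the part above `s` and `j ∈ J` from the
part below. The converse is passage to the quotient. -/

/-! ### Orthogonal families in dual algebras -/

/-- Among pairwise orthogonal self-adjoint elements with a common right unit, only finitely many
are nonzero. -/
def FinitelyManyOrthogonalBelow (B : Type*) [NonUnitalRing B] [StarRing B] : Prop :=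
  ∀ (e : B) (g : ℕ → B), (∀ i, IsSelfAdjoint (g i)) → (Pairwise fun i j => g i * g j = 0) →
    (∀ i, g i * e = g i) → {i | g i ≠ 0}.Finite

theorem FinitelyManyOrthogonalBelow.of_starAlgEquiv {B C : Type*} [NonUnitalRing B] [StarRing B]
    [Module ℂ B] [NonUnitalRing C] [StarRing C] [Module ℂ C] (φ : B ≃⋆ₐ[ℂ] C)
    (hC : FinitelyManyOrthogonalBelow C) : FinitelyManyOrthogonalBelow B := by
  intro e g hsa hort he
  have h := hC (φ e) (fun i => φ (g i)) (fun i => by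
      rw [isSelfAdjoint_iff, ← map_star, (hsa i).star_eq])
    (fun i j hij => by
      show φ (g i) * φ (g j) = 0
      rw [← map_mul, hort hij, map_zero])
    (fun i => by rw [← map_mul, he i])
  refine h.subset fun i hi h0 => hi ?_
  exact φ.injective (h0.trans (map_zero φ).symm)

/-- Normalised, infinitely many such vectors would lie in the relatively compact image of the unit
ball, yet be at mutual distance `√2`. -/
theorem IsCompactOperator.finite_of_pairwise_inner_eq_zero {H : Type*} [NormedAddCommGroup H]
    [InnerProductSpace ℂ H] {T : H →L[ℂ] H} (hT : IsCompactOperator T) {S : Set ℕ} {x : ℕ → H}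
    (hx : ∀ i ∈ S, x i ≠ 0) (hfix : ∀ i, T (x i) = x i)
    (hort : Pairwise fun i j => inner ℂ (x i) (x j) = 0) : S.Finite := by
  by_contra hS
  have hS : S.Infinite := hS
  set k : ℕ → ℕ := fun n => (hS.natEmbedding S n : ℕ)
  have hk : Function.Injective k := fun m n hmn =>
    (hS.natEmbedding S).injective (Subtype.ext hmn)
  have hkS : ∀ n, x (k n) ≠ 0 := fun n => hx _ (hS.natEmbedding S n).2
  set y : ℕ → H := fun n => ((‖x (k n)‖⁻¹ : ℝ) : ℂ) • x (k n) with hy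
  have hy1 : ∀ n, ‖y n‖ = 1 := fun n => by
    have := norm_ne_zero_iff.2 (hkS n)
    simp [hy, norm_smul, this]
  have hyT : ∀ n, T (y n) = y n := fun n => by simp only [hy, map_smul, hfix]
  have hyo : ∀ m n, m ≠ n → inner ℂ (y m) (y n) = 0 := fun m n hmn => by
    simp only [hy, inner_smul_left, inner_smul_right, hort (hk.ne hmn), mul_zero]
  have hcomp := hT.isCompact_closure_image_closedBall (f := (T : H →ₗ[ℂ] H)) (1 : ℝ)
  obtain ⟨z, -, ψ, hψ, hlim⟩ := hcomp.tendsto_subseq (x := y) fun n =>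
    subset_closure ⟨y n, by simp [hy1], hyT n⟩
  obtain ⟨N, hN⟩ := Metric.cauchySeq_iff.1 hlim.cauchySeq 1 one_pos
  have hlt := hN N le_rfl (N + 1) N.le_succ
  have ho := hyo _ _ (hψ.injective.ne N.succ_ne_self.symm)
  have hsq := norm_sub_sq (𝕜 := ℂ) (y (ψ N)) (y (ψ (N + 1)))
  rw [ho, hy1, hy1] at hsq
  rw [Function.comp_apply, Function.comp_apply, dist_eq_norm] at hlt
  norm_num at hsq
  nlinarith [norm_nonneg (y (ψ N) - y (ψ (N + 1)))]

theorem finitelyManyOrthogonalBelow_compactOperators (H : Type*) [NormedAddCommGroup H]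
    [InnerProductSpace ℂ H] [CompleteSpace H] :
    FinitelyManyOrthogonalBelow (compactOperators H) := by
  intro e g hsa hort he
  have hsa' : ∀ i, star (g i : H →L[ℂ] H) = g i := fun i => congrArg Subtype.val (hsa i)
  have hort' : ∀ i j, i ≠ j → (g i : H →L[ℂ] H) * g j = 0 := fun i j hij =>
    congrArg Subtype.val (hort hij)
  -- Taking adjoints turns the right unit `e` into a left one, so the compact operator `e*` fixes
  -- the range of every `g i`.
  have he' : ∀ i, star (e : H →L[ℂ] H) * g i = g i := fun i => by
    have h : (g i : H →L[ℂ] H) * e = g i := congrArg Subtype.val (he i)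
    rw [← hsa' i, ← star_mul, h]
  have hne : ∀ i, ∃ v : H, g i ≠ 0 → (g i : H →L[ℂ] H) v ≠ 0 := fun i => by
    by_contra! hcon
    exact (hcon 0).1 (Subtype.ext (ContinuousLinearMap.ext fun v => (hcon v).2))
  choose v hv using hne
  refine (isCompactOperator_star H e.2).finite_of_pairwise_inner_eq_zero
    (x := fun i => (g i : H →L[ℂ] H) (v i)) (fun i hi => hv i hi)
    (fun i => congrArg (fun T : H →L[ℂ] H => T (v i)) (he' i)) fun i j hij => ?_
  show inner ℂ ((g i : H →L[ℂ] H) (v i)) ((g j : H →L[ℂ] H) (v j)) = 0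
  rw [← ContinuousLinearMap.adjoint_inner_right, ← ContinuousLinearMap.star_eq_adjoint, hsa']
  exact (congrArg (inner ℂ (v i))
    (congrArg (fun T : H →L[ℂ] H => T (v j)) (hort' i j hij))).trans (inner_zero_right _)

/-- Where `‖e t‖ < 1`, the relation `g i t * e t = g i t` forces `g i t = 0`. Only finitely many
coordinates remain, each allowing finitely many `i`. -/
theorem finitelyManyOrthogonalBelow_cstarDirectSum {T : Type*} (K : T → Type*)
    [∀ t, NonUnitalCStarAlgebra (K t)] (hK : ∀ t, FinitelyManyOrthogonalBelow (K t)) :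
    FinitelyManyOrthogonalBelow (cstarDirectSum K) := by
  intro e g hsa hort he
  have hsmall : ∀ᶠ t in cofinite, ‖(e : ∀ t, K t) t‖ < 1 :=
    (show Tendsto (fun t => ‖(e : ∀ t, K t) t‖) cofinite (𝓝 0) from e.2).eventually_lt_const
      one_pos
  have he' : ∀ i t, (g i : ∀ t, K t) t * (e : ∀ t, K t) t = (g i : ∀ t, K t) t := fun i t =>
    congrFun (congrArg Subtype.val (he i)) t
  have hfin : ∀ t, {i | (g i : ∀ t, K t) t ≠ 0}.Finite := fun t =>
    hK t ((e : ∀ t, K t) t) (fun i => (g i : ∀ t, K t) t)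
      (fun i => congrFun (congrArg Subtype.val (hsa i)) t)
      (fun i j hij => congrFun (congrArg Subtype.val (hort hij)) t) (fun i => he' i t)
  refine (Set.Finite.biUnion (eventually_cofinite.1 hsmall) fun t _ => hfin t).subset fun i hi => ?_
  by_contra hcon
  refine hi (Subtype.ext (funext fun t => ?_))
  show (g i : ∀ t, K t) t = 0
  by_cases ht : ‖(e : ∀ t, K t) t‖ < 1
  · have h := norm_mul_le ((g i : ∀ t, K t) t) ((e : ∀ t, K t) t)
    rw [he'] at h
    have h0 := norm_nonneg ((g i : ∀ t, K t) t)
    rw [← norm_le_zero_iff]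
    nlinarith
  · by_contra h0
    exact hcon (Set.mem_biUnion (show t ∈ {t | ¬‖(e : ∀ t, K t) t‖ < 1} from ht) h0)

theorem IsDualAlgebra.finitelyManyOrthogonalBelow {B : Type u} [NonUnitalRing B] [StarRing B]
    [Module ℂ B] (hB : IsDualAlgebra.{u, v, w, z} B) : FinitelyManyOrthogonalBelow B := by
  obtain ⟨T, K, _, hK, ⟨φ⟩⟩ := hB
  refine .of_starAlgEquiv φ (finitelyManyOrthogonalBelow_cstarDirectSum K fun t => ?_)
  obtain ⟨H, _, _, _, ⟨ψ⟩⟩ := hK t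
  exact .of_starAlgEquiv ψ (finitelyManyOrthogonalBelow_compactOperators H)

/-! ### Moore-Penrose inverses and powers of `a* a` -/

/-- If `b` is a Moore-Penrose inverse of `a`, then `(b b*)ⁿ (a* a)ⁿ` is a right unit of `a`. -/
theorem mul_pow_mul_pow_of_isMoorePenroseInverse {R : Type*} [Ring R] [StarRing R] {a b : R}
    (h1 : a * b * a = a) (h2 : b * a * b = b) (h3 : IsSelfAdjoint (a * b))
    (h4 : IsSelfAdjoint (b * a)) (n : ℕ) :
    a * ((b * star b) ^ n * (star a * a) ^ n) = a := by
  have h3' : star b * star a = a * b := by rw [← star_mul, h3.star_eq]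
  have h4' : star a * star b = b * a := by rw [← star_mul, h4.star_eq]
  have hl : b * star b * (star a * a) = b * a := by
    calc b * star b * (star a * a) = b * (star b * star a) * a := by simp only [mul_assoc]
      _ = b * a * b * a := by rw [h3']; simp only [mul_assoc]
      _ = b * a := by rw [h2]
  have hr : star a * a * (b * star b) = b * a := by
    calc star a * a * (b * star b) = star a * (a * b) * star b := by simp only [mul_assoc]
      _ = (star a * star b) * (star a * star b) := by rw [← h3']; simp only [mul_assoc]
      _ = b * a * b * a := by rw [h4']; simp only [mul_assoc]
      _ = b * a := by rw [h2]
  -- Both products equal `b a`, so the expression collapses to `a (b a)ⁿ`.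
  have hc : Commute (b * star b) (star a * a) := hl.trans hr.symm
  rw [← hc.mul_pow, hl]
  induction n with
  | zero => simp
  | succ n ih => rw [pow_succ, ← mul_assoc, ih, ← mul_assoc, h1]

/-! ### Functional calculus of `a* a` and spectral gaps -/

section CStar

variable {A : Type*} [CStarAlgebra A]

/-- The functional calculus of `a* a` at functions that vanish outside `[0, δ)` takes `a` into the
ideal, if powers of `a* a` have approximate inverses modulo it. -/
theorem mul_cfc_mem_of_eqOn_zero {J : Ideal A} (hJ : IsClosed (J : Set A)) [J.IsTwoSided] {a c : A}
    (hac : ∀ n, a - a * (c ^ n * (star a * a) ^ n) ∈ J) {δ : ℝ} (hδ : 0 ≤ δ) (hcδ : ‖c‖ * δ < 1)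
    {k : ℝ → ℝ} (hk : ContinuousOn k (spectrum ℝ (star a * a)))
    (hkδ : ∀ t, δ ≤ t → k t = 0) : a * cfc k (star a * a) ∈ J := by
  set h := star a * a with hh
  have hsa : IsSelfAdjoint h := IsSelfAdjoint.star_mul_self a
  obtain ⟨M, hM⟩ : ∃ M, ∀ t ∈ spectrum ℝ h, ‖k t‖ ≤ M :=
    (ContinuousFunctionalCalculus.isCompact_spectrum (R := ℝ) h).exists_bound_of_continuousOn hk
  have hM' : ∀ t ∈ spectrum ℝ h, ‖k t‖ ≤ |M| := fun t ht => (hM t ht).trans (le_abs_self M)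
  have hbound : ∀ n : ℕ, ‖h ^ n * cfc k h‖ ≤ |M| * δ ^ n := fun n => by
    rw [← cfc_pow_id (R := ℝ) h n, ← cfc_mul (fun t : ℝ => t ^ n) k h (by fun_prop) hk]
    refine norm_cfc_le (by positivity) fun t ht => ?_
    rcases le_or_gt δ t with hle | hlt
    · rw [hkδ t hle, mul_zero, norm_zero]
      positivity
    · have ht0 : 0 ≤ t := spectrum_star_mul_self_nonneg t ht
      rw [norm_mul, norm_pow, Real.norm_of_nonneg ht0, mul_comm]
      have := hM' t ht
      gcongr
  have hlim : Tendsto (fun n : ℕ => a * (c ^ n * (h ^ n * cfc k h))) atTop (𝓝 0) := by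
    have hr : Tendsto (fun n : ℕ => ‖a‖ * (‖(1 : A)‖ * |M| * (‖c‖ * δ) ^ n)) atTop (𝓝 0) := by
      simpa using ((tendsto_pow_atTop_nhds_zero_of_lt_one (by positivity) hcδ).const_mul
        (‖(1 : A)‖ * |M|)).const_mul ‖a‖
    refine squeeze_zero_norm (fun n => ?_) hr
    -- The factor `‖1‖` covers `n = 0` without assuming `A` nontrivial.
    have hcn : ‖c ^ n‖ ≤ ‖(1 : A)‖ * ‖c‖ ^ n := by
      induction n with
      | zero => simp
      | succ n ih =>
        rw [pow_succ, pow_succ, ← mul_assoc]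
        exact (norm_mul_le _ _).trans (by gcongr)
    calc ‖a * (c ^ n * (h ^ n * cfc k h))‖ ≤ ‖a‖ * (‖c ^ n‖ * ‖h ^ n * cfc k h‖) :=
          (norm_mul_le _ _).trans (by gcongr; exact norm_mul_le _ _)
      _ ≤ ‖a‖ * ((‖(1 : A)‖ * ‖c‖ ^ n) * (|M| * δ ^ n)) := by
          gcongr
          exact hbound n
      _ = _ := by rw [mul_pow]; ring
  have hlim' : Tendsto (fun n : ℕ => (a - a * (c ^ n * h ^ n)) * cfc k h) atTop
      (𝓝 (a * cfc k h)) := by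
    simpa [sub_mul, mul_assoc] using (tendsto_const_nhds (x := a * cfc k h)).sub hlim
  exact hJ.mem_of_tendsto hlim' (Eventually.of_forall fun n => J.mul_mem_right _ (hac n))

theorem exists_notMem_spectrum_of_finitelyManyOrthogonalBelow (J : Ideal A) [IsClosedIdeal J]
    (hJ : FinitelyManyOrthogonalBelow (IsClosedIdeal.toStarSubalgebra J)) {h : A}
    (hsa : IsSelfAdjoint h) {f : ℝ → ℝ} (hf : Continuous f) {α β : ℝ} (hαβ : α < β)
    (hf1 : ∀ t, α < t → t < β → f t = 1) (hfJ : cfc f h ∈ J) :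
    ∃ s, α < s ∧ s < β ∧ s ∉ spectrum ℝ h := by
  by_contra! hcon
  -- Increasing from `u 0 = α` towards `β`; the bump `g n` below lives on `(u n, u (n + 1))`.
  set u : ℕ → ℝ := fun n => β - (β - α) / (n + 1) with hu
  have hβα : 0 < β - α := by linarith
  have hu_mono : StrictMono u := strictMono_nat_of_lt_succ fun n => by
    simp only [hu]
    push_cast
    gcongr
    linarith
  have hu_lt : ∀ n, u n < β := fun n => by
    simp only [hu]
    have : 0 < (β - α) / ((n : ℝ) + 1) := by positivity
    linarith
  have hu_ge : ∀ n, α ≤ u n := fun n => by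
    have h0 : u 0 = α := by simp [hu]
    rw [← h0]
    exact hu_mono.monotone n.zero_le
  set g : ℕ → ℝ → ℝ := fun n t => max 0 (t - u n) * max 0 (u (n + 1) - t) with hg
  have hgc : ∀ n, Continuous (g n) := fun n => by
    simp only [hg]
    fun_prop
  have hg0 : ∀ n t, g n t ≠ 0 → u n < t ∧ t < u (n + 1) := fun n t hnt => by
    by_contra hout
    refine hnt ?_
    simp only [hg]
    rcases le_or_gt t (u n) with h1 | h1
    · rw [max_eq_left (sub_nonpos.2 h1), zero_mul]
    · rw [max_eq_left (b := u (n + 1) - t) (sub_nonpos.2 (not_lt.1 fun h2 => hout ⟨h1, h2⟩)),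
        mul_zero]
  have hgf : ∀ n, cfc (g n) h * cfc f h = cfc (g n) h := fun n => by
    rw [← cfc_mul (g n) f h (hgc n).continuousOn hf.continuousOn]
    refine cfc_congr fun t _ => ?_
    by_cases h0 : g n t = 0
    · simp [h0]
    · obtain ⟨h1, h2⟩ := hg0 n t h0
      simp [hf1 t ((hu_ge n).trans_lt h1) (h2.trans (hu_lt _))]
  have hgg : ∀ m n, m < n → ∀ t, g m t * g n t = 0 := fun m n hmn t => by
    by_contra hne
    have h1 := (hg0 m t (left_ne_zero_of_mul hne)).2
    have h2 := (hg0 n t (right_ne_zero_of_mul hne)).1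
    have h3 : u (m + 1) ≤ u n := hu_mono.monotone hmn
    linarith
  have hgJ : ∀ n, cfc (g n) h ∈ J := fun n => by
    rw [← hgf n]
    exact J.mul_mem_left _ hfJ
  have hfin := hJ ⟨cfc f h, hfJ⟩ (fun n => ⟨cfc (g n) h, hgJ n⟩)
    (fun n => Subtype.ext (cfc_predicate (g n) h : IsSelfAdjoint _))
    (fun m n hmn => Subtype.ext (by
      show cfc (g m) h * cfc (g n) h = 0
      rw [← cfc_mul (g m) (g n) h (hgc m).continuousOn (hgc n).continuousOn, ← cfc_zero ℝ h]
      refine cfc_congr fun t _ => ?_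
      rcases hmn.lt_or_gt with hlt | hlt
      · exact hgg m n hlt t
      · exact (mul_comm _ _).trans (hgg n m hlt t)))
    (fun n => Subtype.ext (hgf n))
  refine Set.infinite_univ (hfin.subset fun n _ h0 => ?_)
  have h0 : cfc (g n) h = 0 := congrArg Subtype.val h0
  have hlt : u n < u (n + 1) := hu_mono n.lt_succ_self
  -- At the midpoint the bump is positive, so by spectral mapping `g n` of `h` cannot be zero.
  have hmem : (u n + u (n + 1)) / 2 ∈ spectrum ℝ h :=
    hcon _ (by linarith [hu_ge n]) (by linarith [hu_lt (n + 1)])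
  have hval : g n ((u n + u (n + 1)) / 2) ∈ spectrum ℝ (cfc (g n) h) := by
    rw [cfc_map_spectrum (g n) h hsa (hgc n).continuousOn]
    exact ⟨_, hmem, rfl⟩
  have : Nontrivial A := not_subsingleton_iff_nontrivial.1 fun _ =>
    (spectrum.of_subsingleton (R := ℝ) h ▸ hmem : _ ∈ (∅ : Set ℝ))
  rw [h0, spectrum.zero_eq, Set.mem_singleton_iff] at hval
  have hpos : 0 < g n ((u n + u (n + 1)) / 2) := by
    simp only [hg]
    exact mul_pos (lt_max_of_lt_right (by linarith)) (lt_max_of_lt_right (by linarith))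
  exact hpos.ne' hval

/-- The only possible jump is at `s`, which is not in `S`. -/
theorem continuousOn_ite_lt_of_notMem {S : Set ℝ} {s : ℝ} (hs : s ∉ S) {f g : ℝ → ℝ}
    (hf : ContinuousOn f S) (hg : ContinuousOn g (S ∩ Set.Ici s)) :
    ContinuousOn (fun t => if t < s then f t else g t) S := by
  intro t ht
  rcases lt_or_gt_of_ne (fun h => hs (h ▸ ht) : t ≠ s) with hlt | hlt
  · refine (hf t ht).congr_of_eventuallyEq ?_ (if_pos hlt)
    filter_upwards [mem_nhdsWithin_of_mem_nhds (Iio_mem_nhds hlt)] with x hx using if_pos hx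
  · have h := (hg t ⟨ht, hlt.le⟩).mono_of_mem_nhdsWithin
      (inter_mem_nhdsWithin S (Ici_mem_nhds hlt))
    refine h.congr_of_eventuallyEq ?_ (if_neg hlt.not_gt)
    filter_upwards [mem_nhdsWithin_of_mem_nhds (Ioi_mem_nhds hlt)] with x hx
      using if_neg (not_lt.2 (Set.mem_Ioi.1 hx).le)

/-- Cutting `a` off at a gap `s > 0` of the spectrum of `a* a` gives a Moore-Penrose invertible
element. -/
theorem isMoorePenroseInvertible_mul_cfc {a : A} {s : ℝ} (hs : 0 < s)
    (hgap : s ∉ spectrum ℝ (star a * a)) :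
    IsMoorePenroseInvertible (a * cfc (fun t : ℝ => if t < s then 0 else 1) (star a * a)) := by
  set h := star a * a with hh
  have hsa : IsSelfAdjoint h := IsSelfAdjoint.star_mul_self a
  set p : ℝ → ℝ := fun t => if t < s then 0 else 1 with hp
  set g : ℝ → ℝ := fun t => if t < s then 0 else t⁻¹ with hg
  have hpc : ContinuousOn p (spectrum ℝ h) :=
    continuousOn_ite_lt_of_notMem hgap continuousOn_const continuousOn_const
  have hgc : ContinuousOn g (spectrum ℝ h) :=
    continuousOn_ite_lt_of_notMem hgap continuousOn_const
      (continuousOn_inv₀.mono fun t ht => (hs.trans_le ht.2).ne')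
  have hpsa : IsSelfAdjoint (cfc p h) := cfc_predicate p h
  have hgsa : IsSelfAdjoint (cfc g h) := cfc_predicate g h
  have hpp : cfc p h * cfc p h = cfc p h := by
    rw [← cfc_mul p p h hpc hpc]
    refine cfc_congr fun t _ => ?_
    simp only [hp]
    split_ifs <;> simp
  have hpg : cfc p h * cfc g h = cfc g h := by
    rw [← cfc_mul p g h hpc hgc]
    refine cfc_congr fun t _ => ?_
    simp only [hp, hg]
    split_ifs <;> simp
  have hgh : cfc g h * h = cfc p h := by
    have h1 : cfc g h * h = cfc (fun t : ℝ => g t * t) h := by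
      rw [cfc_mul g (fun t : ℝ => t) h hgc (by fun_prop), cfc_id' ℝ h]
    rw [h1]
    refine cfc_congr fun t _ => ?_
    simp only [hp, hg]
    split_ifs with ht
    · simp
    · exact inv_mul_cancel₀ (hs.trans_le (not_lt.1 ht)).ne'
  have hbm : cfc g h * star a * (a * cfc p h) = cfc p h := by
    calc cfc g h * star a * (a * cfc p h) = cfc g h * h * cfc p h := by
          simp only [hh, mul_assoc]
      _ = cfc p h := by rw [hgh, hpp]
  have hmb : a * cfc p h * (cfc g h * star a) = a * cfc g h * star a := by
    calc a * cfc p h * (cfc g h * star a) = a * (cfc p h * cfc g h) * star a := by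
          simp only [mul_assoc]
      _ = a * cfc g h * star a := by rw [hpg]
  -- Since `g(t) t = p(t)`, this inverse gives the self-adjoint products `p(h)` and `a g(h) a*`.
  refine ⟨cfc g h * star a, ?_, ?_, ?_, ?_⟩
  · rw [mul_assoc, hbm, mul_assoc, hpp]
  · rw [hbm, ← mul_assoc, hpg]
  · rw [hmb]
    exact hgsa.conjugate a
  · rw [hbm]
    exact hpsa

end CStar

/-! ### Passage to the quotient and the main theorem -/

theorem IsMoorePenroseInvertible.quotient_mk {A : Type*} [CStarAlgebra A] (J : Ideal A)
    [IsClosedIdeal J] {m : A} (hm : IsMoorePenroseInvertible m) :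
    IsMoorePenroseInvertible (Ideal.Quotient.mk J m) := by
  obtain ⟨b, h1, h2, h3, h4⟩ := hm
  refine ⟨Ideal.Quotient.mk J b, ?_, ?_, ?_, ?_⟩
  · rw [← map_mul, ← map_mul, h1]
  · rw [← map_mul, ← map_mul, h2]
  · rw [← map_mul]
    exact (IsClosedIdeal.star_mk J _).trans (congrArg _ h3)
  · rw [← map_mul]
    exact (IsClosedIdeal.star_mk J _).trans (congrArg _ h4)

theorem theorem19 {A : Type u} [CStarAlgebra A] (J : Ideal A) [IsClosedIdeal J]
    (hJ : IsDualIdeal.{u, v, w, z} J) (a : A) :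
    IsMoorePenroseInvertible (Ideal.Quotient.mk J a) ↔
      ∃ m j : A, IsMoorePenroseInvertible m ∧ j ∈ J ∧ a = m + j := by
  constructor
  swap
  · rintro ⟨m, j, hm, hj, rfl⟩
    rw [map_add, Ideal.Quotient.eq_zero_iff_mem.2 hj, add_zero]
    exact hm.quotient_mk J
  rintro ⟨B, h1, h2, h3, h4⟩
  obtain ⟨b, rfl⟩ := Ideal.Quotient.mk_surjective B
  set c := b * star b with hc
  set h := star a * a with hh
  have hsa : IsSelfAdjoint h := IsSelfAdjoint.star_mul_self a
  have hac : ∀ n, a - a * (c ^ n * h ^ n) ∈ J := fun n => by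
    rw [← Ideal.Quotient.eq]
    have := mul_pow_mul_pow_of_isMoorePenroseInverse h1 h2 h3 h4 n
    rw [IsClosedIdeal.star_mk, IsClosedIdeal.star_mk] at this
    simp only [hc, hh, map_mul, map_pow]
    exact this.symm
  have hcl : IsClosed (J : Set A) := IsClosedIdeal.isClosed
  set δ : ℝ := 1 / (‖c‖ + 1) with hδ
  have hδ0 : 0 < δ := by positivity
  have hcδ : ‖c‖ * δ < 1 := by
    rw [hδ, mul_one_div, div_lt_one (by positivity)]
    linarith
  -- The numerator is `1` up to `2δ/3` and `0` from `δ` on; the denominator is `t` from `δ/3` on and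
  -- never vanishes. So `t * k t = 1` on `[δ/3, 2δ/3]`.
  set k : ℝ → ℝ := fun t => max 0 (min 1 ((δ - t) / (δ / 3))) / max t (δ / 3) with hk
  have hmax : ∀ t, max t (δ / 3) ≠ 0 := fun t => (lt_max_of_lt_right (by positivity)).ne'
  have hkc : Continuous k := by
    rw [hk]
    exact Continuous.div (by fun_prop) (by fun_prop) hmax
  have hkδ : ∀ t, δ ≤ t → k t = 0 := fun t ht => by
    have : (δ - t) / (δ / 3) ≤ 0 := div_nonpos_of_nonpos_of_nonneg (by linarith) (by positivity)
    simp only [hk]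
    rw [max_eq_left ((min_le_right _ _).trans this), zero_div]
  have hkJ : cfc (fun t => t * k t) h ∈ J := by
    rw [cfc_mul (fun t : ℝ => t) k h (by fun_prop) hkc.continuousOn, cfc_id' ℝ h, hh, mul_assoc]
    exact J.mul_mem_left _ (mul_cfc_mem_of_eqOn_zero hcl hac hδ0.le hcδ hkc.continuousOn hkδ)
  obtain ⟨s, hs1, hs2, hgap⟩ := exists_notMem_spectrum_of_finitelyManyOrthogonalBelow J
    hJ.finitelyManyOrthogonalBelow hsa (f := fun t => t * k t) (by fun_prop)
    (show δ / 3 < 2 * δ / 3 by linarith) (fun t ht1 ht2 => by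
      have h1 : 1 ≤ (δ - t) / (δ / 3) := by
        rw [one_le_div (by positivity)]
        linarith
      simp only [hk]
      rw [min_eq_left h1, max_eq_right zero_le_one, max_eq_left ht1.le]
      exact mul_one_div_cancel (by linarith)) hkJ
  have hs0 : 0 < s := by linarith
  have hpc : ContinuousOn (fun t : ℝ => if t < s then (0 : ℝ) else 1) (spectrum ℝ h) :=
    continuousOn_ite_lt_of_notMem hgap continuousOn_const continuousOn_const
  have hqc : ContinuousOn (fun t : ℝ => if t < s then (1 : ℝ) else 0) (spectrum ℝ h) :=
    continuousOn_ite_lt_of_notMem hgap continuousOn_const continuousOn_const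
  -- The cutoff below `s` vanishes from `δ` on because `s < 2δ/3`, so this summand lies in `J`.
  refine ⟨_, a * cfc (fun t : ℝ => if t < s then (1 : ℝ) else 0) h,
    isMoorePenroseInvertible_mul_cfc hs0 hgap,
    mul_cfc_mem_of_eqOn_zero hcl hac hδ0.le hcδ hqc fun t ht => if_neg (by linarith), ?_⟩
  rw [← mul_add, ← cfc_add h _ _ hpc hqc]
  conv_lhs => rw [← mul_one a, ← cfc_one ℝ h]
  congr 1
  refine cfc_congr fun t _ => ?_
  simp only [Pi.one_apply]
  split_ifs <;> simp
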